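/- Let $(E,\Sigma_E)$ be a measurable space, let $\mu$ be a probability measure on $E$, let $F$ be a metric space with a $\sigma$-algebra containing its open sets, and let $\psi\colon E\to F$ be a diffeomorphism, meaning here any measurable bijection with measurable inverse. Put $d_\psi(x,y)=d_F(\psi(x),\psi(y))$ and $d_\psi(x,A)=\inf_{y\in A}d_\psi(x,y)$ (with $\inf\emptyset=+\infty$), and for $\epsilon>0$ let $A^\psi_\epsilon=\{x\in E: d_\psi(x,A)<\epsilon\}$. The $\psi$-perimeter of a measurable set $A\subseteq E$ is $$\mu^{+,\psi}(A)=\liminf_{\epsilon\to0^+}\frac{\mu(A^\psi_\epsilon)-\mu(A)}{\epsilon}\in[0,\infty],$$ and the $\psi$-isoperimetric profile of $\mu$ is $$I^\psi_\mu(v)=\inf\{\mu^{+,\psi}(A): A\subseteq E \text{ measurable},\ \mu(A)=v\}\in[0,\infty].$$ Let $\psi_*\mu$ be the pushforward of $\mu$ to $F$, $(\psi_*\mu)(B)=\mu(\psi^{-1}(B))$. Then $$I^\psi_\mu=I^{\mathrm{id}}_{\psi_*\mu}.$$ In particular, if $F=\mathbb{R}^n$ with $n\ge1$ and the Euclidean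 metric, and if $\psi_*\mu=\gamma$ is the standard Gaussian measure on $\mathbb{R}^n$, then $$I^\psi_\mu(v)=\varphi(\Phi^{-1}(v))\qquad\text{for all } v\in[0,1],$$ where $\varphi$ and $\Phi$ are the density and the distribution function of the standard normal law on $\mathbb{R}$, and where the right-hand side is read as $0$ for $v\in\{0,1\}$. -/

import Mathlib

open MeasureTheory ProbabilityTheory Filter Set
open scoped ENNReal Topology

namespace PsiIso

noncomputable section

/-- The `ψ`-distance on `E`: the pullback `d_ψ(x, y) = d_F(ψ(x), ψ(y))` of the metric of `F`. -/
def psiDist {E F : Type*} [MetricSpace F] (ψ : E → F) (x y : E) : ℝ :=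
  dist (ψ x) (ψ y)

/-- The `ψ`-distance `d_ψ(x, A) = inf_{y ∈ A} d_ψ(x, y)` of a point to a set
(equal to `∞` when `A` is empty). -/
def psiDistToSet {E F : Type*} [MetricSpace F] (ψ : E → F) (x : E) (A : Set E) : ℝ≥0∞ :=
  ⨅ y ∈ A, ENNReal.ofReal (psiDist ψ x y)

/-- The open `ψ`-enlargement `A_ε^ψ = {x : d_ψ(x, A) < ε}`. -/
def psiEnlargement {E F : Type*} [MetricSpace F] (ψ : E → F) (ε : ℝ) (A : Set E) : Set E :=
  {x | psiDistToSet ψ x A < ENNReal.ofReal ε}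

/-- The `ψ`-perimeter of `A` with respect to `μ`:
the lower limit, as `ε ↓ 0`, of `(μ(A_ε^ψ) - μ(A)) / ε`, as an element of `[0, ∞]`. The truncated
subtraction is the true one when `μ` is finite, because `A ⊆ A_ε^ψ` for `ε > 0`. -/
def psiPerimeter {E F : Type*} [MeasurableSpace E] [MetricSpace F]
    (ψ : E → F) (μ : Measure E) (A : Set E) : ℝ≥0∞ :=
  liminf (fun ε : ℝ => (μ (psiEnlargement ψ ε A) - μ A) / ENNReal.ofReal ε) (𝓝[>] 0)

/-- The `ψ`-isoperimetric profile of a probability measure `μ`: the infimum of the `ψ`-perimeters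
of the measurable sets of measure `v` (equal to `∞` when there is no such set). -/
def psiProfile {E F : Type*} [MeasurableSpace E] [MetricSpace F]
    (ψ : E → F) (μ : Measure E) (v : ℝ) : ℝ≥0∞ :=
  ⨅ (A : Set E) (_ : MeasurableSet A) (_ : μ.real A = v), psiPerimeter ψ μ A

/-- The density `φ` of the standard normal distribution on `ℝ`. -/
def normalPDF (x : ℝ) : ℝ := gaussianPDFReal 0 1 x

/-- The distribution function `Φ` of the standard normal distribution on `ℝ`. -/
def normalCDF (x : ℝ) : ℝ := cdf (gaussianReal 0 1) x

/-- The inverse function `Φ⁻¹` of `Φ : ℝ → (0, 1)` (with no meaning outside `(0, 1)`). -/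
def normalCDFInv (v : ℝ) : ℝ := Function.invFun normalCDF v

/-- The enlargement contains the set. -/
theorem subset_psiEnlargement {E F : Type*} [MetricSpace F] (ψ : E → F) {ε : ℝ} (hε : 0 < ε)
    (A : Set E) : A ⊆ psiEnlargement ψ ε A := by
  intro x hx
  have h : psiDistToSet ψ x A ≤ ENNReal.ofReal (psiDist ψ x x) := iInf₂_le x hx
  refine lt_of_le_of_lt h ?_
  simpa [psiDist] using hε

theorem normalCDF_strictMono : StrictMono normalCDF := by
  intro a b hab
  have hpos : 0 < gaussianReal 0 1 (Ioc a b) := by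
    rw [pos_iff_ne_zero]
    intro h0
    have := gaussianReal_absolutelyContinuous' 0 (v := 1) one_ne_zero h0
    simp at this
    linarith
  have h := (cdf (gaussianReal 0 1)).measure_Ioc a b
  rw [measure_cdf] at h
  rw [h] at hpos
  simpa [normalCDF] using hpos

theorem normalCDF_continuous : Continuous normalCDF := by
  rw [continuous_iff_continuousAt]
  intro x
  have := nullSingletonClass_gaussianReal (μ := 0) (v := 1) one_ne_zero
  have h := (cdf (gaussianReal 0 1)).measure_singleton x
  rw [measure_cdf, measure_singleton] at h
  have hle : normalCDF x ≤ Function.leftLim normalCDF x := by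
    have := ENNReal.ofReal_eq_zero.1 h.symm
    exact sub_nonpos.1 this
  have hmono := normalCDF_strictMono.monotone
  rw [hmono.continuousAt_iff_leftLim_eq_rightLim]
  have hr : Function.rightLim normalCDF x = normalCDF x :=
    (cdf (gaussianReal 0 1)).rightLim_eq x
  rw [hr]
  exact le_antisymm (hmono.leftLim_le le_rfl) hle

/-- `Φ⁻¹` is a right inverse of `Φ` on `(0, 1)`. -/
theorem normalCDF_normalCDFInv {v : ℝ} (hv : v ∈ Ioo (0 : ℝ) 1) :
    normalCDF (normalCDFInv v) = v := by
  apply Function.invFun_eq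
  have h0 := (tendsto_cdf_atBot (gaussianReal 0 1)).eventually (gt_mem_nhds hv.1)
  have h1 := (tendsto_cdf_atTop (gaussianReal 0 1)).eventually (lt_mem_nhds hv.2)
  obtain ⟨a, ha⟩ := h0.exists
  obtain ⟨b, hb⟩ := h1.exists
  exact mem_range_of_exists_le_of_exists_ge normalCDF_continuous ⟨a, ha.le⟩ ⟨b, hb.le⟩

/-- `Φ⁻¹` is a left inverse of `Φ`. -/
theorem normalCDFInv_normalCDF (x : ℝ) : normalCDFInv (normalCDF x) = x :=
  Function.leftInverse_invFun normalCDF_strictMono.injective x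

end

end PsiIso

namespace PsiIso

open scoped RealInnerProductSpace Convolution NNReal

/-! The map ψ is an isometry from `d_ψ` to the metric of F and carries μ to its pushforward, so it
matches sets, enlargements, measures and perimeters. This is the transfer `psiProfile_eq_map`.

In the Gaussian case, half-spaces give the upper bound: the ε-enlargement of {⟨e, x⟩ ≤ t} lies in
{⟨e, x⟩ ≤ t + ε}, and Φ has derivative φ.

The lower bound is Bobkov's functional inequality I(∫ f) ≤ ∫ √(I(f)² + |∇f|²) for I = φ ∘ Φ⁻¹. Its
two-point version `gaussIso_midpoint_le` follows from the differential equation I I'' = -1. The form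
√(I² + D²) makes it stable under adding independent steps, which gives the random walk version
`gaussIso_walkAvg_le`. The central limit theorem then yields `gaussIso_integral_le`.

Applied to a smoothed cutoff that is 1 on A and 0 outside the ε-enlargement, with gradient about 1/ε
in between, it bounds I at a value close to γ(A) by about γ(A_ε \ A)/ε. Letting ε tend to 0 along a
suitable sequence gives I(γ(A)) as a lower bound for the perimeter. -/

/-! ### The normal law and the function I = φ ∘ Φ⁻¹ -/

theorem normalPDF_eq (x : ℝ) :
    normalPDF x = (√(2 * Real.pi))⁻¹ * Real.exp (-x ^ 2 / 2) := by
  simp [normalPDF, gaussianPDFReal]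

theorem normalPDF_pos (x : ℝ) : 0 < normalPDF x :=
  gaussianPDFReal_pos 0 1 x one_ne_zero

theorem hasDerivAt_normalPDF (x : ℝ) : HasDerivAt normalPDF (-x * normalPDF x) x := by
  have h : HasDerivAt (fun y : ℝ => -y ^ 2 / 2) (-x) x := by
    have := ((hasDerivAt_id x).pow 2).neg.div_const 2
    exact this.congr_deriv (by simp only [id, Nat.cast_ofNat]; ring)
  have h2 := (h.exp).const_mul (√(2 * Real.pi))⁻¹
  rw [show normalPDF = fun y => (√(2 * Real.pi))⁻¹ * Real.exp (-y ^ 2 / 2) from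
    funext normalPDF_eq]
  refine h2.congr_deriv ?_
  ring

theorem normalPDF_continuous : Continuous normalPDF :=
  continuous_iff_continuousAt.2 fun x => (hasDerivAt_normalPDF x).continuousAt

theorem normalPDF_le_of_abs_le {x y : ℝ} (h : |y| ≤ |x|) : normalPDF x ≤ normalPDF y := by
  rw [normalPDF_eq, normalPDF_eq]
  have := sq_le_sq.2 h
  gcongr

theorem normalPDF_neg (x : ℝ) : normalPDF (-x) = normalPDF x := by
  simp [normalPDF_eq]

theorem normalPDF_le_one (x : ℝ) : normalPDF x ≤ 1 := by
  rw [normalPDF_eq]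
  have h1 : 1 ≤ √(2 * Real.pi) := by
    rw [Real.one_le_sqrt]
    nlinarith [Real.pi_gt_three]
  have h2 : Real.exp (-x ^ 2 / 2) ≤ 1 := by
    rw [Real.exp_le_one_iff]
    nlinarith [sq_nonneg x]
  exact mul_le_one₀ (inv_le_one_of_one_le₀ h1) (Real.exp_pos _).le h2

theorem tendsto_normalPDF_atTop : Tendsto normalPDF atTop (𝓝 0) := by
  rw [show normalPDF = fun y => (√(2 * Real.pi))⁻¹ * Real.exp (-y ^ 2 / 2) from
    funext normalPDF_eq]
  have h : Tendsto (fun y : ℝ => -(y ^ 2 / 2)) atTop atBot :=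
    tendsto_neg_atTop_atBot.comp ((tendsto_pow_atTop two_ne_zero).atTop_div_const two_pos)
  have := (Real.tendsto_exp_atBot.comp h).const_mul (√(2 * Real.pi))⁻¹
  simpa [Function.comp_def, neg_div] using this

theorem normalCDF_eq_integral (x : ℝ) : normalCDF x = ∫ y in Iic x, normalPDF y := by
  rw [normalCDF, cdf_eq_real, measureReal_def, gaussianReal_apply_eq_integral 0 one_ne_zero,
    ENNReal.toReal_ofReal]
  · rfl
  · exact integral_nonneg fun y => gaussianPDFReal_nonneg 0 1 y

theorem hasDerivAt_normalCDF (x : ℝ) : HasDerivAt normalCDF (normalPDF x) x := by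
  have hint : Integrable normalPDF := integrable_gaussianPDFReal 0 1
  have h : normalCDF = fun y => normalCDF 0 + ∫ t in (0 : ℝ)..y, normalPDF t := by
    ext y
    rw [normalCDF_eq_integral, normalCDF_eq_integral,
      ← intervalIntegral.integral_Iic_sub_Iic hint.integrableOn hint.integrableOn]
    ring
  rw [h]
  exact (intervalIntegral.integral_hasDerivAt_right hint.intervalIntegrable
    normalPDF_continuous.aestronglyMeasurable.stronglyMeasurableAtFilter
    normalPDF_continuous.continuousAt).const_add _

theorem normalCDF_mem_Ioo (x : ℝ) : normalCDF x ∈ Ioo (0 : ℝ) 1 :=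
  ⟨(cdf_nonneg (μ := gaussianReal 0 1) (x - 1)).trans_lt (normalCDF_strictMono (sub_one_lt x)),
    (normalCDF_strictMono (lt_add_one x)).trans_le (cdf_le_one (μ := gaussianReal 0 1) (x + 1))⟩

theorem normalCDF_neg (x : ℝ) : normalCDF (-x) = 1 - normalCDF x := by
  have hd : ∀ y, HasDerivAt (fun y => normalCDF y + normalCDF (-y)) 0 y := fun y => by
    have h := (hasDerivAt_normalCDF y).add
      ((hasDerivAt_normalCDF (-y)).comp y (hasDerivAt_neg y))
    rw [normalPDF_neg] at h
    refine h.congr_deriv ?_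
    ring
  have hc : ∀ y, normalCDF y + normalCDF (-y) = normalCDF x + normalCDF (-x) := fun y =>
    is_const_of_deriv_eq_zero (fun z => (hd z).differentiableAt) (fun z => (hd z).deriv) y x
  have hlim : Tendsto (fun y => normalCDF y + normalCDF (-y)) atTop (𝓝 (1 + 0)) :=
    (tendsto_cdf_atTop (gaussianReal 0 1)).add
      ((tendsto_cdf_atBot (gaussianReal 0 1)).comp tendsto_neg_atTop_atBot)
  have := tendsto_nhds_unique hlim (tendsto_const_nhds.congr fun y => (hc y).symm)
  linarith

theorem normalCDFInv_strictMonoOn : StrictMonoOn normalCDFInv (Ioo 0 1) := by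
  intro a ha b hb hab
  rw [← normalCDF_strictMono.lt_iff_lt, normalCDF_normalCDFInv ha, normalCDF_normalCDFInv hb]
  exact hab

theorem normalCDFInv_one_sub {v : ℝ} (hv : v ∈ Ioo (0 : ℝ) 1) :
    normalCDFInv (1 - v) = -normalCDFInv v := by
  conv_lhs => rw [← normalCDF_normalCDFInv hv, ← normalCDF_neg, normalCDFInv_normalCDF]

theorem hasDerivAt_normalCDFInv {v : ℝ} (hv : v ∈ Ioo (0 : ℝ) 1) :
    HasDerivAt normalCDFInv (normalPDF (normalCDFInv v))⁻¹ v := by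
  have hc : ContinuousAt normalCDFInv v := by
    -- A monotone function cannot jump if its image is a neighbourhood of the value; here the image
    -- is all of ℝ.
    refine normalCDFInv_strictMonoOn.continuousAt_of_image_mem_nhds (Ioo_mem_nhds hv.1 hv.2) ?_
    convert univ_mem
    exact eq_univ_of_forall fun x => ⟨_, normalCDF_mem_Ioo x, normalCDFInv_normalCDF x⟩
  refine HasDerivAt.of_local_left_inverse hc (hasDerivAt_normalCDF _) (normalPDF_pos _).ne' ?_
  filter_upwards [Ioo_mem_nhds hv.1 hv.2] with w hw using normalCDF_normalCDFInv hw

/-- The Gaussian isoperimetric function `φ ∘ Φ⁻¹`. -/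
noncomputable def gaussIso (v : ℝ) : ℝ := normalPDF (normalCDFInv v)

theorem gaussIso_pos (v : ℝ) : 0 < gaussIso v := normalPDF_pos _

theorem gaussIso_le_one (v : ℝ) : gaussIso v ≤ 1 := normalPDF_le_one _

/-- From φ' = -xφ and (Φ⁻¹)' = 1/I. Differentiating once more gives I I'' = -1, the only analytic
input on I besides its symmetry about 1/2. -/
theorem hasDerivAt_gaussIso {v : ℝ} (hv : v ∈ Ioo (0 : ℝ) 1) :
    HasDerivAt gaussIso (-normalCDFInv v) v := by
  have h := (hasDerivAt_normalPDF (normalCDFInv v)).comp v (hasDerivAt_normalCDFInv hv)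
  refine h.congr_deriv ?_
  have := (normalPDF_pos (normalCDFInv v)).ne'
  field_simp

theorem continuousOn_gaussIso : ContinuousOn gaussIso (Ioo 0 1) :=
  fun _ hv => (hasDerivAt_gaussIso hv).continuousAt.continuousWithinAt

theorem hasDerivAt_gaussIso_mul_normalCDFInv {v : ℝ} (hv : v ∈ Ioo (0 : ℝ) 1) :
    HasDerivAt (fun v => gaussIso v * normalCDFInv v) (1 - normalCDFInv v ^ 2) v := by
  have h := (hasDerivAt_gaussIso hv).mul (hasDerivAt_normalCDFInv hv)
  refine h.congr_deriv ?_
  have := (normalPDF_pos (normalCDFInv v)).ne'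
  simp only [gaussIso]
  field_simp
  ring

theorem gaussIso_one_sub {v : ℝ} (hv : v ∈ Ioo (0 : ℝ) 1) : gaussIso (1 - v) = gaussIso v := by
  rw [gaussIso, normalCDFInv_one_sub hv, normalPDF_neg, gaussIso]

/-! ### Bobkov's two-point inequality -/

theorem nonneg_of_hasDerivAt {F F' : ℝ → ℝ} {x : ℝ} (hx : 0 ≤ x)
    (hF : ∀ y ∈ Icc 0 x, HasDerivAt F (F' y) y) (hF' : ∀ y ∈ Icc 0 x, 0 ≤ F' y) (h0 : 0 ≤ F 0) :
    0 ≤ F x := by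
  have hm : MonotoneOn F (Icc 0 x) := by
    refine monotoneOn_of_deriv_nonneg (convex_Icc 0 x)
      (fun y hy => (hF y hy).continuousAt.continuousWithinAt)
      (fun y hy => (hF y (interior_subset hy)).differentiableAt.differentiableWithinAt)
      (fun y hy => ?_)
    rw [(hF y (interior_subset hy)).deriv]
    exact hF' y (interior_subset hy)
  exact h0.trans (hm ⟨le_rfl, hx⟩ ⟨hx, le_rfl⟩ hx)

theorem nonneg_of_second_deriv_nonneg {F F' F'' : ℝ → ℝ} {x : ℝ} (hx : 0 ≤ x)
    (hF : ∀ y ∈ Icc 0 x, HasDerivAt F (F' y) y) (hF' : ∀ y ∈ Icc 0 x, HasDerivAt F' (F'' y) y)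
    (hF'' : ∀ y ∈ Icc 0 x, 0 ≤ F'' y) (h0 : 0 ≤ F 0) (h1 : 0 ≤ F' 0) : 0 ≤ F x :=
  nonneg_of_hasDerivAt hx hF (fun _ hy => nonneg_of_hasDerivAt hy.1
    (fun z hz => hF' z ⟨hz.1, hz.2.trans hy.2⟩) (fun z hz => hF'' z ⟨hz.1, hz.2.trans hy.2⟩) h1) h0

/-- With q = Φ⁻¹ one has (q²)' = 2q/φ(q), so this monotonicity is what makes q² convex. -/
theorem monotone_div_normalPDF : Monotone fun s => s / normalPDF s := by
  have hd : ∀ s, HasDerivAt (fun s => s / normalPDF s) ((1 + s ^ 2) / normalPDF s) s := fun s => by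
    have h := (hasDerivAt_id s).div (hasDerivAt_normalPDF s) (normalPDF_pos s).ne'
    refine h.congr_deriv ?_
    have := (normalPDF_pos s).ne'
    simp only [id]
    field_simp
    ring
  refine monotone_of_deriv_nonneg (fun s => (hd s).differentiableAt) fun s => ?_
  rw [(hd s).deriv]
  have := normalPDF_pos s
  positivity

section TwoPoint

variable {c x : ℝ}

theorem add_sub_mem_Ioo {y : ℝ} (h1 : 0 < c - x) (h2 : c + x < 1) (hy : y ∈ Icc 0 x) :
    c + y ∈ Ioo (0 : ℝ) 1 ∧ c - y ∈ Ioo (0 : ℝ) 1 := by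
  obtain ⟨hy0, hyx⟩ := hy
  refine ⟨⟨?_, ?_⟩, ⟨?_, ?_⟩⟩ <;> linarith

theorem HasDerivAt.comp_add_left {f : ℝ → ℝ} {f' y : ℝ} (h : HasDerivAt f f' (c + y)) :
    HasDerivAt (fun y => f (c + y)) f' y := by
  exact (h.comp y ((hasDerivAt_id y).const_add c)).congr_deriv (mul_one _)

theorem HasDerivAt.comp_sub_left {f : ℝ → ℝ} {f' y : ℝ} (h : HasDerivAt f f' (c - y)) :
    HasDerivAt (fun y => f (c - y)) (-f') y := by
  exact (h.comp y ((hasDerivAt_id y).const_sub c)).congr_deriv (mul_neg_one _)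

theorem hasDerivAt_gaussIso_sq {v : ℝ} (hv : v ∈ Ioo (0 : ℝ) 1) :
    HasDerivAt (fun v => gaussIso v ^ 2) (-2 * (gaussIso v * normalCDFInv v)) v := by
  refine ((hasDerivAt_gaussIso hv).pow 2).congr_deriv ?_
  ring

theorem two_mul_sq_normalCDFInv_le (hx : 0 ≤ x) (h1 : 0 < c - x) (h2 : c + x < 1) :
    2 * normalCDFInv c ^ 2 ≤ normalCDFInv (c + x) ^ 2 + normalCDFInv (c - x) ^ 2 := by
  have hq : ∀ {v : ℝ}, v ∈ Ioo (0 : ℝ) 1 → HasDerivAt (fun v => normalCDFInv v ^ 2)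
      (2 * (normalCDFInv v / normalPDF (normalCDFInv v))) v := fun hv => by
    refine ((hasDerivAt_normalCDFInv hv).pow 2).congr_deriv ?_
    ring
  have := nonneg_of_hasDerivAt
    (F := fun y => normalCDFInv (c + y) ^ 2 + normalCDFInv (c - y) ^ 2 - 2 * normalCDFInv c ^ 2) hx
    (fun y hy => ((HasDerivAt.comp_add_left (hq (add_sub_mem_Ioo h1 h2 hy).1)).add
      (HasDerivAt.comp_sub_left (hq (add_sub_mem_Ioo h1 h2 hy).2))).sub_const _)
    (fun y hy => by
      have hm := monotone_div_normalPDF (normalCDFInv_strictMonoOn.monotoneOn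
        (add_sub_mem_Ioo h1 h2 hy).2 (add_sub_mem_Ioo h1 h2 hy).1 (by linarith [hy.1]))
      simp only at hm
      linarith)
    (by simp only [add_zero, sub_zero]; linarith)
  linarith

/-- Since (I²)'' = 2q² - 2 with q = Φ⁻¹, the second derivative in x of the difference of the two
sides is 2(q(c+x)² + q(c-x)² - 2q(c)²), nonnegative by midpoint convexity of q². The value and the
first derivative vanish at 0. -/
theorem gaussIso_sq_add_sq (hx : 0 ≤ x) (h1 : 0 < c - x) (h2 : c + x < 1) :
    2 * gaussIso c ^ 2 + 2 * normalCDFInv c ^ 2 * x ^ 2 ≤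
      gaussIso (c + x) ^ 2 + gaussIso (c - x) ^ 2 + 2 * x ^ 2 := by
  have := nonneg_of_second_deriv_nonneg
    (F := fun y => gaussIso (c + y) ^ 2 + gaussIso (c - y) ^ 2 +
      (2 - 2 * normalCDFInv c ^ 2) * y ^ 2 - 2 * gaussIso c ^ 2)
    (F' := fun y => -2 * (gaussIso (c + y) * normalCDFInv (c + y)) +
      2 * (gaussIso (c - y) * normalCDFInv (c - y)) + (4 - 4 * normalCDFInv c ^ 2) * y)
    (F'' := fun y => -2 * (1 - normalCDFInv (c + y) ^ 2) +
      2 * -(1 - normalCDFInv (c - y) ^ 2) + (4 - 4 * normalCDFInv c ^ 2)) hx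
    (fun y hy => by
      obtain ⟨hp, hm⟩ := add_sub_mem_Ioo h1 h2 hy
      have h := (((HasDerivAt.comp_add_left (hasDerivAt_gaussIso_sq hp)).add
        (HasDerivAt.comp_sub_left (hasDerivAt_gaussIso_sq hm))).add
        (((hasDerivAt_id y).pow 2).const_mul (2 - 2 * normalCDFInv c ^ 2))).sub_const
          (2 * gaussIso c ^ 2)
      refine h.congr_deriv ?_
      simp
      ring)
    (fun y hy => by
      obtain ⟨hp, hm⟩ := add_sub_mem_Ioo h1 h2 hy
      have h := (((HasDerivAt.comp_add_left
        (hasDerivAt_gaussIso_mul_normalCDFInv hp)).const_mul (-2)).add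
        ((HasDerivAt.comp_sub_left
          (hasDerivAt_gaussIso_mul_normalCDFInv hm)).const_mul 2)).add
        ((hasDerivAt_id y).const_mul (4 - 4 * normalCDFInv c ^ 2))
      refine h.congr_deriv ?_
      simp)
    (fun y hy => by
      have := two_mul_sq_normalCDFInv_le hy.1 (by linarith [hy.2] : 0 < c - y)
        (by linarith [hy.2])
      linarith)
    (by simp only [add_zero, sub_zero]; apply le_of_eq; ring) (by simp)
  linarith

theorem abs_normalCDFInv_add_le (hx : 0 ≤ x) (h1 : 0 < c - x) (h2 : c + x < 1) (hc : c ≤ 1 / 2) :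
    |normalCDFInv (c + x)| ≤ |normalCDFInv (c - x)| := by
  obtain ⟨hp, hm⟩ := add_sub_mem_Ioo h1 h2 ⟨hx, le_rfl⟩
  have hs := normalCDFInv_one_sub hm
  have hm' : 1 - (c - x) ∈ Ioo (0 : ℝ) 1 := ⟨by linarith [hm.2], by linarith [hm.1]⟩
  have hle1 := normalCDFInv_strictMonoOn.monotoneOn hm hp (by linarith)
  have hle2 := normalCDFInv_strictMonoOn.monotoneOn hp hm' (by linarith)
  rw [hs] at hle2
  refine (abs_le.2 ⟨?_, ?_⟩ : _ ≤ -normalCDFInv (c - x)).trans (neg_le_abs _) <;> linarith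

/-- For c ≤ 1/2 the odd part I(c+x)² - I(c-x)² is nonnegative and concave in x ≥ 0, because c + x is
closer to 1/2 than c - x is. It therefore lies below its tangent at 0, whose slope is -4 I(c)
Φ⁻¹(c). -/
theorem abs_gaussIso_sq_sub_sq_le (hx : 0 ≤ x) (h1 : 0 < c - x) (h2 : c + x < 1)
    (hc : c ≤ 1 / 2) :
    (gaussIso (c + x) ^ 2 - gaussIso (c - x) ^ 2) ^ 2 ≤
      (4 * gaussIso c * normalCDFInv c * x) ^ 2 := by
  have hle : gaussIso (c - x) ≤ gaussIso (c + x) :=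
    normalPDF_le_of_abs_le (abs_normalCDFInv_add_le hx h1 h2 hc)
  have hle2 := pow_le_pow_left₀ (gaussIso_pos (c - x)).le hle 2
  have := nonneg_of_second_deriv_nonneg
    (F := fun y => -4 * gaussIso c * normalCDFInv c * y -
      (gaussIso (c + y) ^ 2 - gaussIso (c - y) ^ 2))
    (F' := fun y => -4 * gaussIso c * normalCDFInv c +
      2 * (gaussIso (c + y) * normalCDFInv (c + y)) + 2 * (gaussIso (c - y) * normalCDFInv (c - y)))
    (F'' := fun y => 2 * (1 - normalCDFInv (c + y) ^ 2) +
      2 * -(1 - normalCDFInv (c - y) ^ 2)) hx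
    (fun y hy => by
      obtain ⟨hp, hm⟩ := add_sub_mem_Ioo h1 h2 hy
      have h := ((hasDerivAt_id y).const_mul (-4 * gaussIso c * normalCDFInv c)).sub
        ((HasDerivAt.comp_add_left (hasDerivAt_gaussIso_sq hp)).sub
        (HasDerivAt.comp_sub_left (hasDerivAt_gaussIso_sq hm)))
      refine h.congr_deriv ?_
      ring)
    (fun y hy => by
      obtain ⟨hp, hm⟩ := add_sub_mem_Ioo h1 h2 hy
      exact (((HasDerivAt.comp_add_left
        (hasDerivAt_gaussIso_mul_normalCDFInv hp)).const_mul 2).const_add _).add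
        ((HasDerivAt.comp_sub_left
          (hasDerivAt_gaussIso_mul_normalCDFInv hm)).const_mul 2))
    (fun y hy => by
      have := sq_le_sq.2 (abs_normalCDFInv_add_le hy.1 (by linarith [hy.2] : 0 < c - y)
        (by linarith [hy.2]) hc)
      linarith)
    (by simp) (by simp only [add_zero, sub_zero]; apply le_of_eq; ring)
  rw [sq_le_sq, abs_of_nonneg (by linarith)]
  refine le_trans ?_ (neg_le_abs _)
  linarith

/-- With P = (s+t)² and Q = (s-t)² ≤ P, the hypothesis reads (P - 4m²)(Q - 4m²) ≤ 0, which forces P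
≥ 4m². This removes the square roots from the two-point inequality. -/
theorem two_mul_le_add_of_sq_sub_sq {m s t : ℝ} (hm : 0 < m) (hs : 0 ≤ s) (ht : 0 ≤ t)
    (h : (s ^ 2 - t ^ 2) ^ 2 ≤ 8 * m ^ 2 * (s ^ 2 + t ^ 2 - 2 * m ^ 2)) : 2 * m ≤ s + t := by
  by_contra! hlt
  have h1 : (s + t) ^ 2 < 4 * m ^ 2 := by nlinarith
  have h2 : (s - t) ^ 2 ≤ (s + t) ^ 2 := by nlinarith [mul_nonneg hs ht]
  nlinarith [mul_pos (sub_pos.2 h1) (sub_pos.2 (h2.trans_lt h1))]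

theorem two_mul_gaussIso_le (hx : 0 ≤ x) (h1 : 0 < c - x) (h2 : c + x < 1) :
    2 * gaussIso c ≤ √(gaussIso (c + x) ^ 2 + x ^ 2) + √(gaussIso (c - x) ^ 2 + x ^ 2) := by
  have key : (gaussIso (c + x) ^ 2 - gaussIso (c - x) ^ 2) ^ 2 ≤
      (4 * gaussIso c * normalCDFInv c * x) ^ 2 := by
    -- The symmetry v ↦ 1 - v of I reduces the case c ≥ 1/2 to c ≤ 1/2.
    rcases le_total c (1 / 2) with hc | hc
    · exact abs_gaussIso_sq_sub_sq_le hx h1 h2 hc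
    · obtain ⟨hp, hm⟩ := add_sub_mem_Ioo h1 h2 ⟨hx, le_rfl⟩
      have h := abs_gaussIso_sq_sub_sq_le (c := 1 - c) hx (by linarith) (by linarith)
        (by linarith)
      rw [show 1 - c + x = 1 - (c - x) by ring, show 1 - c - x = 1 - (c + x) by ring,
        gaussIso_one_sub hp, gaussIso_one_sub hm, gaussIso_one_sub ⟨by linarith, by linarith⟩,
        normalCDFInv_one_sub ⟨by linarith, by linarith⟩] at h
      nlinarith [h]
  have hsum := gaussIso_sq_add_sq hx h1 h2
  apply two_mul_le_add_of_sq_sub_sq (gaussIso_pos c) (Real.sqrt_nonneg _) (Real.sqrt_nonneg _)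
  rw [Real.sq_sqrt (by positivity), Real.sq_sqrt (by positivity)]
  nlinarith [mul_le_mul_of_nonneg_left hsum (by positivity : 0 ≤ 8 * gaussIso c ^ 2)]

/-- **Bobkov's two-point inequality.** -/
theorem gaussIso_midpoint_le {a b : ℝ} (ha : a ∈ Ioo (0 : ℝ) 1) (hb : b ∈ Ioo (0 : ℝ) 1) :
    gaussIso ((a + b) / 2) ≤ (√(gaussIso a ^ 2 + ((a - b) / 2) ^ 2) +
      √(gaussIso b ^ 2 + ((a - b) / 2) ^ 2)) / 2 := by
  wlog hab : b ≤ a generalizing a b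
  · have := this hb ha (le_of_not_ge hab)
    rw [add_comm b a, show (b - a) / 2 = -((a - b) / 2) by ring, neg_sq] at this
    linarith
  have := two_mul_gaussIso_le (c := (a + b) / 2) (x := (a - b) / 2) (by linarith)
    (by linarith [hb.1]) (by linarith [ha.2])
  rw [show (a + b) / 2 + (a - b) / 2 = a by ring, show (a + b) / 2 - (a - b) / 2 = b by ring]
    at this
  linarith

end TwoPoint

/-! ### Bobkov's inequality for random walks -/

section Walk

variable {V : Type*} [AddCommGroup V]

/-- Average of `f` over the end point of the random walk started at `x` that makes, for each `h` in
the list, an independent step `h` or `-h` with probability `1 / 2` each. -/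
noncomputable def walkAvg : List V → (V → ℝ) → V → ℝ
  | [], f => f
  | h :: l, f => fun x => (walkAvg l f (x + h) + walkAvg l f (x - h)) / 2

/-- Half of the larger one of the two increments of `f` at `y` in the directions `± 2h`. -/
noncomputable def halfIncr (f : V → ℝ) (h y : V) : ℝ :=
  max (|f (y + (h + h)) - f y| / 2) (|f (y - (h + h)) - f y| / 2)

theorem walkAvg_mono (l : List V) {f g : V → ℝ} (h : ∀ x, f x ≤ g x) (x : V) :
    walkAvg l f x ≤ walkAvg l g x := by
  induction l generalizing x with
  | nil => exact h x
  | cons a l ih => simp only [walkAvg]; linarith [ih (x + a), ih (x - a)]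

theorem walkAvg_mem_Ioo (l : List V) {f : V → ℝ} (h : ∀ x, f x ∈ Ioo (0 : ℝ) 1) (x : V) :
    walkAvg l f x ∈ Ioo (0 : ℝ) 1 := by
  induction l generalizing x with
  | nil => exact h x
  | cons a l ih =>
    obtain ⟨h1, h2⟩ := ih (x + a)
    obtain ⟨h3, h4⟩ := ih (x - a)
    exact ⟨by simp only [walkAvg]; linarith, by simp only [walkAvg]; linarith⟩

theorem walkAvg_sub (l : List V) (f g : V → ℝ) (x : V) :
    walkAvg l (fun y => f y - g y) x = walkAvg l f x - walkAvg l g x := by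
  induction l generalizing x with
  | nil => rfl
  | cons a l ih => simp only [walkAvg, ih]; ring

theorem walkAvg_comp_add_right (l : List V) (f : V → ℝ) (z x : V) :
    walkAvg l (fun y => f (y + z)) x = walkAvg l f (x + z) := by
  induction l generalizing x with
  | nil => rfl
  | cons a l ih => simp only [walkAvg, ih]; rw [add_right_comm, sub_add_eq_add_sub]

theorem walkAvg_mul_const (l : List V) (f : V → ℝ) (c : ℝ) (x : V) :
    walkAvg l (fun y => f y * c) x = walkAvg l f x * c := by
  induction l generalizing x with
  | nil => rfl
  | cons a l ih => simp only [walkAvg, ih]; ring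

theorem walkAvg_const (l : List V) (c : ℝ) (x : V) : walkAvg l (fun _ => c) x = c := by
  induction l generalizing x with
  | nil => rfl
  | cons a l ih => simp only [walkAvg, ih]; ring

theorem abs_walkAvg_le (l : List V) (f : V → ℝ) (x : V) :
    |walkAvg l f x| ≤ walkAvg l (fun y => |f y|) x := by
  induction l generalizing x with
  | nil => exact le_rfl
  | cons a l ih =>
    simp only [walkAvg]
    rw [abs_div, abs_two]
    linarith [abs_add_le (walkAvg l f (x + a)) (walkAvg l f (x - a)), ih (x + a), ih (x - a)]

/-- Midpoint convexity of the Euclidean norm on ℝ², by Cauchy–Schwarz. -/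
theorem sqrt_add_sq_midpoint_le (a b c d : ℝ) :
    √(((a + b) / 2) ^ 2 + ((c + d) / 2) ^ 2) ≤ (√(a ^ 2 + c ^ 2) + √(b ^ 2 + d ^ 2)) / 2 := by
  rw [Real.sqrt_le_left (by positivity)]
  have h1 := Real.sq_sqrt (by positivity : 0 ≤ a ^ 2 + c ^ 2)
  have h2 := Real.sq_sqrt (by positivity : 0 ≤ b ^ 2 + d ^ 2)
  have h3 : a * b + c * d ≤ √(a ^ 2 + c ^ 2) * √(b ^ 2 + d ^ 2) := by
    rw [← Real.sqrt_mul (by positivity)]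
    exact Real.le_sqrt_of_sq_le (by nlinarith [sq_nonneg (a * d - b * c)])
  nlinarith

theorem sqrt_walkAvg_sq_add_sq_le (l : List V) (f g : V → ℝ) (x : V) :
    √(walkAvg l f x ^ 2 + walkAvg l g x ^ 2) ≤ walkAvg l (fun y => √(f y ^ 2 + g y ^ 2)) x := by
  induction l generalizing x with
  | nil => exact le_rfl
  | cons a l ih =>
    refine (sqrt_add_sq_midpoint_le _ _ _ _).trans ?_
    simp only [walkAvg]
    linarith [ih (x + a), ih (x - a)]

/-- Averaging commutes with translations, so the difference between x + h and x - h is an average of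
increments of f over 2h, seen from either end point. The maximum in `halfIncr` lets one function
serve both ends. -/
theorem abs_walkAvg_sub_div_two_le (l : List V) (f : V → ℝ) (h x : V) :
    |(walkAvg l f (x + h) - walkAvg l f (x - h)) / 2| ≤ walkAvg l (halfIncr f h) (x + h) ∧
    |(walkAvg l f (x + h) - walkAvg l f (x - h)) / 2| ≤ walkAvg l (halfIncr f h) (x - h) := by
  have e1 : (walkAvg l f (x + h) - walkAvg l f (x - h)) / 2 =
      walkAvg l (fun y => (f y - f (y + -(h + h))) * 2⁻¹) (x + h) := by
    rw [walkAvg_mul_const, walkAvg_sub, walkAvg_comp_add_right,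
      show x + h + -(h + h) = x - h by abel, div_eq_mul_inv]
  have e2 : (walkAvg l f (x + h) - walkAvg l f (x - h)) / 2 =
      walkAvg l (fun y => (f (y + (h + h)) - f y) * 2⁻¹) (x - h) := by
    rw [walkAvg_mul_const, walkAvg_sub, walkAvg_comp_add_right,
      show x - h + (h + h) = x + h by abel, div_eq_mul_inv]
  constructor
  · rw [e1]
    refine (abs_walkAvg_le _ _ _).trans (walkAvg_mono _ (fun y => ?_) _)
    rw [abs_mul, abs_sub_comm, ← sub_eq_add_neg, abs_of_pos (by norm_num : (0 : ℝ) < 2⁻¹),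
      ← div_eq_mul_inv]
    exact le_max_right _ _
  · rw [e2]
    refine (abs_walkAvg_le _ _ _).trans (walkAvg_mono _ (fun y => ?_) _)
    rw [abs_mul, abs_of_pos (by norm_num : (0 : ℝ) < 2⁻¹), ← div_eq_mul_inv]
    exact le_max_left _ _

theorem list_sum_sq_nonneg {W : Type*} (l : List W) (u : W → ℝ) : 0 ≤ (l.map fun h => u h ^ 2).sum :=
  List.sum_nonneg fun a ha => by
    obtain ⟨h, -, rfl⟩ := List.mem_map.1 ha
    positivity

/-- **Bobkov's inequality** for a random walk. -/
theorem gaussIso_walkAvg_le (l : List V) {f : V → ℝ} (hf : ∀ x, f x ∈ Ioo (0 : ℝ) 1) (x : V) :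
    gaussIso (walkAvg l f x) ≤
      walkAvg l (fun y => √(gaussIso (f y) ^ 2 + (l.map fun h => halfIncr f h y ^ 2).sum)) x := by
  induction l generalizing x with
  | nil => simp [walkAvg, Real.sqrt_sq (gaussIso_pos _).le]
  | cons h l ih =>
    -- The two-point inequality for the first step leaves one square root at each end point z = x ±
    -- h. The induction hypothesis bounds I there, and convexity of the norm moves the average
    -- outside, adding the new squared increment to the sum.
    have hstep : ∀ z, |(walkAvg l f (x + h) - walkAvg l f (x - h)) / 2| ≤
        walkAvg l (halfIncr f h) z →
        √(gaussIso (walkAvg l f z) ^ 2 + ((walkAvg l f (x + h) - walkAvg l f (x - h)) / 2) ^ 2) ≤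
        walkAvg l (fun y => √(gaussIso (f y) ^ 2 +
          ((h :: l).map fun h => halfIncr f h y ^ 2).sum)) z := fun z hz => by
      calc _ ≤ √(walkAvg l (fun y => √(gaussIso (f y) ^ 2 +
              (l.map fun h => halfIncr f h y ^ 2).sum)) z ^ 2 +
              walkAvg l (halfIncr f h) z ^ 2) := by
            apply Real.sqrt_le_sqrt
            apply add_le_add
            · exact pow_le_pow_left₀ (gaussIso_pos _).le (ih z) 2
            · rw [← sq_abs]
              exact pow_le_pow_left₀ (abs_nonneg _) hz 2
        _ ≤ _ := sqrt_walkAvg_sq_add_sq_le _ _ _ _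
        _ ≤ _ := by
          refine walkAvg_mono _ (fun y => ?_) _
          rw [Real.sq_sqrt (add_nonneg (sq_nonneg _) (list_sum_sq_nonneg _ _))]
          apply Real.sqrt_le_sqrt
          simp only [List.map_cons, List.sum_cons]
          linarith
    obtain ⟨h1, h2⟩ := abs_walkAvg_sub_div_two_le l f h x
    refine (gaussIso_midpoint_le (walkAvg_mem_Ioo l hf _) (walkAvg_mem_Ioo l hf _)).trans ?_
    simp only [walkAvg]
    linarith [hstep _ h1, hstep _ h2]

end Walk

theorem integrable_of_continuous_of_bound {X : Type*} [TopologicalSpace X] [MeasurableSpace X]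
    [OpensMeasurableSpace X] {μ : Measure X} [IsFiniteMeasure μ] {F : X → ℝ}
    (hF : Continuous F) {C : ℝ} (hC : ∀ x, |F x| ≤ C) : Integrable F μ :=
  Integrable.of_bound hF.aestronglyMeasurable C (ae_of_all _ hC)

/-! ### The walk as a measure, and its Gaussian limit -/

section WalkMeasure

variable {V : Type*} [NormedAddCommGroup V] [MeasurableSpace V]

/-- The uniform distribution on `{h, -h}`. -/
noncomputable def coinMeasure (h : V) : Measure V :=
  (2⁻¹ : ℝ≥0∞) • Measure.dirac h + (2⁻¹ : ℝ≥0∞) • Measure.dirac (-h)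

instance isProbabilityMeasure_coinMeasure (h : V) : IsProbabilityMeasure (coinMeasure h) :=
  ⟨by simp [coinMeasure, ENNReal.inv_two_add_inv_two]⟩

theorem integral_coinMeasure {G : Type*} [NormedAddCommGroup G] [NormedSpace ℝ G]
    [CompleteSpace G] (h : V)
    {F : V → G} (hF : StronglyMeasurable F) :
    ∫ x, F x ∂coinMeasure h = (2⁻¹ : ℝ) • (F h + F (-h)) := by
  have hi : ∀ y : V, Integrable F ((2⁻¹ : ℝ≥0∞) • Measure.dirac y) := fun y =>
    (integrable_dirac' hF (by simp)).smul_measure (by simp)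
  rw [coinMeasure, integral_add_measure (hi _) (hi _), integral_smul_measure,
    integral_smul_measure, integral_dirac' _ _ hF, integral_dirac' _ _ hF]
  simp

variable [BorelSpace V]

theorem charFun_coinMeasure [InnerProductSpace ℝ V] (h t : V) :
    charFun (coinMeasure h) t = Complex.cos (⟪h, t⟫ : ℝ) := by
  rw [charFun_apply, integral_coinMeasure]
  · rw [Complex.cos, inner_neg_left, Complex.real_smul]
    push_cast
    ring_nf
  · have : Continuous fun x : V => Complex.exp ((⟪x, t⟫ : ℝ) * Complex.I) := by fun_prop
    exact this.stronglyMeasurable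

/-- The distribution of the sum of independent steps, uniform on `{h, -h}` for the `h` in the
list. -/
noncomputable def walkMeasure : List V → Measure V
  | [] => Measure.dirac 0
  | h :: l => walkMeasure l ∗ coinMeasure h

variable [SecondCountableTopology V]

instance isProbabilityMeasure_walkMeasure (l : List V) : IsProbabilityMeasure (walkMeasure l) := by
  induction l with
  | nil => exact inferInstanceAs (IsProbabilityMeasure (Measure.dirac 0))
  | cons h l ih => exact inferInstanceAs (IsProbabilityMeasure (walkMeasure l ∗ coinMeasure h))

theorem integral_walkMeasure_add (l : List V) {F : V → ℝ} (hF : Continuous F) {C : ℝ}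
    (hC : ∀ x, |F x| ≤ C) (x : V) : ∫ y, F (x + y) ∂walkMeasure l = walkAvg l F x := by
  induction l generalizing x with
  | nil => simp [walkMeasure, walkAvg]
  | cons h l ih =>
    have hi : ∀ (μ : Measure V) [IsFiniteMeasure μ] (z : V), Integrable (fun y => F (z + y)) μ :=
      fun μ _ z => integrable_of_continuous_of_bound (by fun_prop) fun y => hC _
    have hinner : ∀ y, ∫ z, F (x + (y + z)) ∂coinMeasure h =
        2⁻¹ * (F (x + h + y) + F (x - h + y)) := fun y => by
      rw [integral_coinMeasure h (Continuous.stronglyMeasurable (by fun_prop)), smul_eq_mul,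
        show x + (y + h) = x + h + y by abel, show x + (y + -h) = x - h + y by abel]
    simp only [walkMeasure]
    rw [integral_conv (hi _ x)]
    simp only [hinner]
    rw [integral_const_mul, integral_add (hi _ _) (hi _ _), ih, ih, walkAvg]
    ring

theorem integral_walkMeasure (l : List V) {F : V → ℝ} (hF : Continuous F) {C : ℝ}
    (hC : ∀ x, |F x| ≤ C) : ∫ y, F y ∂walkMeasure l = walkAvg l F 0 := by
  simpa using integral_walkMeasure_add l hF hC 0

theorem charFun_walkMeasure [InnerProductSpace ℝ V] (l : List V) (t : V) :
    charFun (walkMeasure l) t = (l.map fun h => Complex.cos (⟪h, t⟫ : ℝ)).prod := by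
  induction l with
  | nil => simp [walkMeasure]
  | cons h l ih => simp [walkMeasure, charFun_conv, charFun_coinMeasure, ih, mul_comm]

end WalkMeasure

/-- The cosine is the characteristic function of a fair sign, so this is the one-dimensional central
limit theorem for signs. -/
theorem tendsto_cos_pow (t : ℝ) :
    Tendsto (fun k : ℕ => Complex.cos (((√k)⁻¹ * t : ℝ) : ℂ) ^ k) atTop
      (𝓝 (Complex.exp (-t ^ 2 / 2))) := by
  have h := tendsto_charFun_inv_sqrt_mul_pow (P := coinMeasure (1 : ℝ)) (X := id)
    aemeasurable_id (by
      have := integral_coinMeasure (1 : ℝ) stronglyMeasurable_id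
      simpa using this)
    (by
      have := integral_coinMeasure (1 : ℝ) (F := fun x : ℝ => x ^ 2)
        (Continuous.stronglyMeasurable (by fun_prop))
      norm_num at this
      simpa using this) t
  simpa [charFun_coinMeasure, mul_comm] using h

section Limit

variable {ι V : Type*} [Fintype ι] [NormedAddCommGroup V] [InnerProductSpace ℝ V]

/-- The list in which each vector `b i / √k` occurs `k` times. -/
noncomputable def scaledSteps (b : OrthonormalBasis ι ℝ V) (k : ℕ) : List V :=
  (Finset.univ : Finset ι).toList.flatMap fun i => List.replicate k ((√k)⁻¹ • b i)

theorem prod_map_scaledSteps {M : Type*} [CommMonoid M] (b : OrthonormalBasis ι ℝ V) (k : ℕ)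
    (g : V → M) : ((scaledSteps b k).map g).prod = ∏ i, g ((√k)⁻¹ • b i) ^ k := by
  simp only [scaledSteps, List.map_flatMap, List.map_replicate]
  rw [← Finset.prod_map_toList]
  induction (Finset.univ : Finset ι).toList with
  | nil => simp
  | cons i l ih => simp [ih]

theorem sum_map_scaledSteps (b : OrthonormalBasis ι ℝ V) (k : ℕ) (g : V → ℝ) :
    ((scaledSteps b k).map g).sum = k * ∑ i, g ((√k)⁻¹ • b i) := by
  have := congrArg Multiplicative.toAdd
    (prod_map_scaledSteps b k fun v => Multiplicative.ofAdd (g v))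
  rw [Finset.mul_sum]
  simpa [← ofAdd_list_prod, toAdd_list_sum, Function.comp_def] using this

variable [FiniteDimensional ℝ V] [MeasurableSpace V] [BorelSpace V]

/-- **Central limit theorem** for the walk along `scaledSteps`. -/
theorem tendsto_walkAvg_scaledSteps (b : OrthonormalBasis ι ℝ V) {F : V → ℝ} (hF : Continuous F)
    {C : ℝ} (hC : ∀ x, |F x| ≤ C) :
    Tendsto (fun k => walkAvg (scaledSteps b k) F 0) atTop (𝓝 (∫ x, F x ∂stdGaussian V)) := by
  let P : ℕ → ProbabilityMeasure V := fun k => ⟨walkMeasure (scaledSteps b k), inferInstance⟩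
  let Q : ProbabilityMeasure V := ⟨stdGaussian V, inferInstance⟩
  have hPQ : Tendsto P atTop (𝓝 Q) := by
    refine ProbabilityMeasure.tendsto_of_tendsto_charFun fun t => ?_
    simp only [P, Q, ProbabilityMeasure.coe_mk, charFun_walkMeasure, charFun_stdGaussian,
      prod_map_scaledSteps, real_inner_smul_left]
    have h := tendsto_finsetProd (Finset.univ : Finset ι) fun i _ => tendsto_cos_pow ⟪b i, t⟫
    convert h using 2
    -- By Parseval, the product of the coordinate limits is exp(-‖t‖²/2), the characteristic
    -- function of the standard Gaussian.
    rw [← Complex.exp_sum, ← Finset.sum_div, Finset.sum_neg_distrib]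
    norm_cast
    rw [b.sum_sq_inner_right]
  have h := (ProbabilityMeasure.tendsto_iff_forall_integral_tendsto.1 hPQ)
    (BoundedContinuousFunction.ofNormedAddCommGroup F hF C hC)
  simpa [P, Q, integral_walkMeasure _ hF hC] using h

end Limit

/-! ### Increments of functions with Lipschitz derivative -/

section Taylor

variable {V : Type*} [NormedAddCommGroup V] [NormedSpace ℝ V]

theorem abs_sub_sub_le_of_lipschitz_fderiv {f : V → ℝ} {f' : V → V →L[ℝ] ℝ} {K : ℝ}
    (hf : ∀ x, HasFDerivAt f (f' x) x) (hK : ∀ x y, ‖f' x - f' y‖ ≤ K * ‖x - y‖) (hK0 : 0 ≤ K)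
    (y v : V) : |f (y + v) - f y - f' y v| ≤ K * ‖v‖ ^ 2 := by
  have h := (convex_closedBall y ‖v‖).norm_image_sub_le_of_norm_hasFDerivWithin_le'
    (f := f) (f' := f') (φ := f' y) (C := K * ‖v‖) (x := y) (y := y + v)
    (fun x _ => (hf x).hasFDerivWithinAt)
    (fun x hx => (hK x y).trans
      (mul_le_mul_of_nonneg_left (by simpa [dist_eq_norm] using hx) hK0))
    (Metric.mem_closedBall_self (norm_nonneg _)) (by simp)
  rw [add_sub_cancel_left, Real.norm_eq_abs] at h
  linarith [h]

/-- The first-order Taylor bound for the displacements ±2h, halved: the error K‖2h‖² becomes 2K‖h‖².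
-/
theorem halfIncr_le_of_lipschitz_fderiv {f : V → ℝ} {f' : V → V →L[ℝ] ℝ} {K : ℝ}
    (hf : ∀ x, HasFDerivAt f (f' x) x) (hK : ∀ x y, ‖f' x - f' y‖ ≤ K * ‖x - y‖) (hK0 : 0 ≤ K)
    (h y : V) : halfIncr f h y ≤ |f' y h| + 2 * K * ‖h‖ ^ 2 := by
  have hn : ‖h + h‖ ^ 2 = 4 * ‖h‖ ^ 2 := by
    rw [← two_smul ℝ h, norm_smul]
    norm_num [mul_pow]
  have h1 := abs_sub_sub_le_of_lipschitz_fderiv hf hK hK0 y (h + h)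
  have h2 := abs_sub_sub_le_of_lipschitz_fderiv hf hK hK0 y (-(h + h))
  rw [norm_neg, map_neg, ← sub_eq_add_neg] at h2
  rw [hn, map_add, abs_le] at h1 h2
  have h3 := neg_abs_le (f' y h)
  have h4 := le_abs_self (f' y h)
  refine max_le ?_ ?_
  · rw [div_le_iff₀ two_pos, abs_le]
    constructor <;> linarith
  · rw [div_le_iff₀ two_pos, abs_le]
    constructor <;> linarith

theorem sq_halfIncr_le_of_lipschitz_fderiv {f : V → ℝ} {f' : V → V →L[ℝ] ℝ} {K L : ℝ}
    (hf : ∀ x, HasFDerivAt f (f' x) x) (hK : ∀ x y, ‖f' x - f' y‖ ≤ K * ‖x - y‖) (hK0 : 0 ≤ K)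
    (hL : ∀ x, ‖f' x‖ ≤ L) (h y : V) :
    halfIncr f h y ^ 2 ≤ f' y h ^ 2 + (4 * K * L * ‖h‖ ^ 3 + 4 * K ^ 2 * ‖h‖ ^ 4) := by
  have h1 := halfIncr_le_of_lipschitz_fderiv hf hK hK0 h y
  have h0 : 0 ≤ halfIncr f h y := le_max_of_le_left (by positivity)
  have h2 : |f' y h| ≤ L * ‖h‖ :=
    ((f' y).le_opNorm h).trans (mul_le_mul_of_nonneg_right (hL y) (norm_nonneg h))
  have h3 := pow_le_pow_left₀ h0 h1 2
  rw [add_sq, sq_abs] at h3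
  nlinarith [mul_le_mul_of_nonneg_left h2 (by positivity : 0 ≤ 4 * K * ‖h‖ ^ 2)]

end Taylor

theorem sqrt_add_le {x : ℝ} (hx : 0 ≤ x) (y : ℝ) : √(x + y) ≤ √x + √y := by
  rcases le_total y 0 with hy | hy
  · exact (Real.sqrt_le_sqrt (by linarith)).trans (le_add_of_nonneg_right (Real.sqrt_nonneg y))
  · refine Real.sqrt_le_iff.2 ⟨by positivity, ?_⟩
    have := mul_nonneg (Real.sqrt_nonneg x) (Real.sqrt_nonneg y)
    rw [add_sq, Real.sq_sqrt hx, Real.sq_sqrt hy]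
    linarith

theorem integral_mem_Icc {X : Type*} [TopologicalSpace X] [MeasurableSpace X]
    [OpensMeasurableSpace X] {μ : Measure X} [IsProbabilityMeasure μ] {f : X → ℝ} {a b : ℝ}
    (hf : Continuous f) (hab : ∀ x, f x ∈ Icc a b) : ∫ x, f x ∂μ ∈ Icc a b := by
  have hi : Integrable f μ := integrable_of_continuous_of_bound hf (C := max |a| |b|)
    fun x => abs_le_max_abs_abs (hab x).1 (hab x).2
  constructor
  · simpa using integral_mono (integrable_const a) hi fun x => (hab x).1
  · simpa using integral_mono hi (integrable_const b) fun x => (hab x).2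

/-! ### Bobkov's inequality for the Gaussian measure -/

section Bobkov

variable {V : Type*} [NormedAddCommGroup V] [InnerProductSpace ℝ V]

/-- The k steps of size 1/√k in each direction contribute (f' bᵢ)² with total weight k · (1/√k)² =
1, and the Taylor errors are O(1/√k). -/
theorem sum_sq_halfIncr_scaledSteps_le {ι : Type*} [Fintype ι] (b : OrthonormalBasis ι ℝ V)
    {f : V → ℝ} {f' : V → V →L[ℝ] ℝ} {K L : ℝ}
    (hf : ∀ x, HasFDerivAt f (f' x) x) (hK : ∀ x y, ‖f' x - f' y‖ ≤ K * ‖x - y‖) (hK0 : 0 ≤ K)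
    (hL : ∀ x, ‖f' x‖ ≤ L) {k : ℕ} (hk : 0 < k) (y : V) :
    ((scaledSteps b k).map fun h => halfIncr f h y ^ 2).sum ≤
      ‖f' y‖ ^ 2 + Fintype.card ι * (4 * K * L * (√k)⁻¹ + 4 * K ^ 2 * (√k)⁻¹ ^ 2) := by
  have hk' : (0 : ℝ) < k := by exact_mod_cast hk
  set s : ℝ := (√k)⁻¹ with hs
  have hs0 : 0 < s := by positivity
  have hks : k * s ^ 2 = 1 := by
    rw [hs, inv_pow, Real.sq_sqrt hk'.le]
    field_simp
  have hterm : ∀ i, halfIncr f (s • b i) y ^ 2 ≤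
      s ^ 2 * (f' y (b i) ^ 2 + (4 * K * L * s + 4 * K ^ 2 * s ^ 2)) := fun i => by
    have h := sq_halfIncr_le_of_lipschitz_fderiv hf hK hK0 hL (s • b i) y
    rw [norm_smul, b.norm_eq_one, mul_one, Real.norm_of_nonneg hs0.le, map_smul, smul_eq_mul] at h
    refine h.trans (le_of_eq ?_)
    ring
  rw [sum_map_scaledSteps, b.norm_dual]
  calc _ ≤ (k : ℝ) * ∑ i, s ^ 2 * (f' y (b i) ^ 2 + (4 * K * L * s + 4 * K ^ 2 * s ^ 2)) :=
        mul_le_mul_of_nonneg_left (Finset.sum_le_sum fun i _ => hterm i) hk'.le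
    _ = _ := by
        rw [← Finset.mul_sum, ← mul_assoc, hks, one_mul, Finset.sum_add_distrib,
          Finset.sum_const, Finset.card_univ, nsmul_eq_mul]

variable [FiniteDimensional ℝ V] [MeasurableSpace V] [BorelSpace V]

/-- **Bobkov's inequality** for the standard Gaussian measure. -/
theorem gaussIso_integral_le {f : V → ℝ} {f' : V → V →L[ℝ] ℝ} {K L a b : ℝ}
    (hf : ∀ x, HasFDerivAt f (f' x) x) (hK : ∀ x y, ‖f' x - f' y‖ ≤ K * ‖x - y‖) (hK0 : 0 ≤ K)
    (hL : ∀ x, ‖f' x‖ ≤ L) (ha : 0 < a) (hb : b < 1) (hab : ∀ x, f x ∈ Icc a b) :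
    gaussIso (∫ x, f x ∂stdGaussian V) ≤
      ∫ x, √(gaussIso (f x) ^ 2 + ‖f' x‖ ^ 2) ∂stdGaussian V := by
  have hL0 : 0 ≤ L := (norm_nonneg _).trans (hL 0)
  have hsub : Icc a b ⊆ Ioo 0 1 := Icc_subset_Ioo ha hb
  have hfc : Continuous f := continuous_iff_continuousAt.2 fun x => (hf x).continuousAt
  have hf'c : Continuous f' := by
    refine (LipschitzWith.of_dist_le_mul (K := ⟨K, hK0⟩) fun x y => ?_).continuous
    rw [dist_eq_norm, dist_eq_norm]
    exact hK x y
  have hfb : ∀ x, |f x| ≤ 1 := fun x =>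
    abs_le.2 ⟨by linarith [(hsub (hab x)).1], (hsub (hab x)).2.le⟩
  set H : V → ℝ := fun x => √(gaussIso (f x) ^ 2 + ‖f' x‖ ^ 2) with hH
  have hIf : Continuous fun x => gaussIso (f x) :=
    continuousOn_gaussIso.comp_continuous hfc fun x => hsub (hab x)
  have hHc : Continuous H := by fun_prop
  have hHb : ∀ x, |H x| ≤ 1 + L := fun x => by
    rw [abs_of_nonneg (Real.sqrt_nonneg _)]
    refine Real.sqrt_le_iff.2 ⟨by positivity, ?_⟩
    have h1 := pow_le_pow_left₀ (gaussIso_pos _).le (gaussIso_le_one (f x)) 2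
    have h2 := pow_le_pow_left₀ (norm_nonneg _) (hL x) 2
    nlinarith
  let B := stdOrthonormalBasis ℝ V
  set e : ℕ → ℝ := fun k => Fintype.card (Fin (Module.finrank ℝ V)) *
    (4 * K * L * (√k)⁻¹ + 4 * K ^ 2 * (√k)⁻¹ ^ 2) with he
  have hs : Tendsto (fun k : ℕ => (√(k : ℝ))⁻¹) atTop (𝓝 0) :=
    tendsto_inv_atTop_zero.comp (Real.tendsto_sqrt_atTop.comp tendsto_natCast_atTop_atTop)
  have hetend : Tendsto (fun k => √(e k)) atTop (𝓝 0) := by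
    have := (((hs.const_mul (4 * K * L)).add ((hs.pow 2).const_mul (4 * K ^ 2))).const_mul
      (Fintype.card (Fin (Module.finrank ℝ V)) : ℝ)).sqrt
    rw [zero_pow two_ne_zero, mul_zero, mul_zero, add_zero, mul_zero, Real.sqrt_zero] at this
    exact this
  have hlim1 : Tendsto (fun k => gaussIso (walkAvg (scaledSteps B k) f 0)) atTop
      (𝓝 (gaussIso (∫ x, f x ∂stdGaussian V))) :=
    (continuousOn_gaussIso.continuousAt (isOpen_Ioo.mem_nhds
      (hsub (integral_mem_Icc hfc hab)))).tendsto.comp (tendsto_walkAvg_scaledSteps B hfc hfb)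
  have hlim2 := (tendsto_walkAvg_scaledSteps B hHc hHb).add hetend
  rw [add_zero] at hlim2
  refine le_of_tendsto_of_tendsto hlim1 hlim2 ?_
  filter_upwards [eventually_gt_atTop 0] with k hk
  refine (gaussIso_walkAvg_le _ (fun x => hsub (hab x)) 0).trans ?_
  have hconst : walkAvg (scaledSteps B k) H 0 + √(e k) =
      walkAvg (scaledSteps B k) (fun y => H y - -√(e k)) 0 := by
    rw [walkAvg_sub, walkAvg_const, sub_neg_eq_add]
  rw [hconst]
  refine walkAvg_mono _ (fun y => ?_) _
  rw [sub_neg_eq_add]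
  refine le_trans (Real.sqrt_le_sqrt ?_) (sqrt_add_le (by positivity) _)
  rw [add_assoc]
  exact add_le_add_right (sum_sq_halfIncr_scaledSteps_le B hf hK hK0 hL hk y) _

end Bobkov

/-- A weighted form of Bobkov's inequality for functions that may attain the values `0` and `1`. -/
theorem gaussIso_integral_le_measureReal {V : Type*} [NormedAddCommGroup V]
    [InnerProductSpace ℝ V] [FiniteDimensional ℝ V] [MeasurableSpace V] [BorelSpace V]
    {g : V → ℝ} {g' : V → V →L[ℝ] ℝ} {K L : ℝ}
    (hg : ∀ x, HasFDerivAt g (g' x) x) (hK : ∀ x y, ‖g' x - g' y‖ ≤ K * ‖x - y‖) (hK0 : 0 ≤ K)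
    (hL : ∀ x, ‖g' x‖ ≤ L) (h01 : ∀ x, g x ∈ Icc (0 : ℝ) 1)
    (hm : ∫ x, g x ∂stdGaussian V ∈ Ioo (0 : ℝ) 1) {S : Set V} (hS : MeasurableSet S)
    (hgS : ∀ x ∉ S, g x = 0 ∨ g x = 1) :
    gaussIso (∫ x, g x ∂stdGaussian V) ≤ (1 + L) * (stdGaussian V).real S := by
  have hgc : Continuous g := continuous_iff_continuousAt.2 fun x => (hg x).continuousAt
  -- Outside S the function g attains its extreme value 0 or 1, so its derivative vanishes.
  have hg0 : ∀ x ∉ S, g' x = 0 := fun x hx => by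
    rcases hgS x hx with h | h
    · exact IsLocalMin.hasFDerivAt_eq_zero (Eventually.of_forall fun y => h ▸ (h01 y).1) (hg x)
    · exact IsLocalMax.hasFDerivAt_eq_zero (Eventually.of_forall fun y => h ▸ (h01 y).2) (hg x)
  have hL0 : 0 ≤ L := (norm_nonneg _).trans (hL 0)
  have hgi : Integrable g (stdGaussian V) := integrable_of_continuous_of_bound hgc (C := 1)
    fun x => abs_le.2 ⟨by linarith [(h01 x).1], (h01 x).2⟩
  -- The values 0 and 1 lie outside the domain where Φ⁻¹ has meaning, so g is rescaled to [Φ(-M),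
  -- Φ(M)]. Outside S the integrand is then exactly φ(M), which vanishes as M → ∞.
  have hM : ∀ M : ℝ, 0 < M → gaussIso (normalCDF (-M) +
      (normalCDF M - normalCDF (-M)) * ∫ x, g x ∂stdGaussian V) ≤
      normalPDF M + (1 + L) * (stdGaussian V).real S := fun M hM0 => by
    set a := normalCDF (-M) with ha
    set b := normalCDF M with hb
    have hab : a ≤ b := normalCDF_strictMono.monotone (by linarith)
    have ha0 : 0 < a := (normalCDF_mem_Ioo _).1
    have hb1 : b < 1 := (normalCDF_mem_Ioo _).2
    have hba0 : 0 ≤ b - a := sub_nonneg.2 hab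
    have hba1 : b - a ≤ 1 := by linarith
    have hnorm : ∀ φ : V →L[ℝ] ℝ, ‖(b - a) • φ‖ ≤ ‖φ‖ := fun φ => by
      rw [norm_smul, Real.norm_of_nonneg hba0]
      exact mul_le_of_le_one_left (norm_nonneg _) hba1
    have h := gaussIso_integral_le (f := fun x => a + (b - a) * g x)
      (f' := fun x => (b - a) • g' x) (K := K) (L := L) (a := a) (b := b)
      (fun x => ((hg x).const_mul (b - a)).const_add a)
      (fun x y => ((congrArg norm (smul_sub (b - a) (g' x) (g' y)).symm).trans_le (hnorm _)).trans (hK x y)) hK0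
      (fun x => (hnorm _).trans (hL x)) ha0 hb1
      (fun x => ⟨by nlinarith [(h01 x).1], by nlinarith [(h01 x).2]⟩)
    rw [integral_add (integrable_const _) (hgi.const_mul _), integral_const_mul] at h
    simp only [integral_const, probReal_univ, smul_eq_mul, one_mul] at h
    refine h.trans ?_
    have hi : Integrable (fun x => normalPDF M + S.indicator (fun _ => 1 + L) x) (stdGaussian V) :=
      (integrable_const _).add ((integrable_const _).indicator hS)
    have hpt : ∀ x, √(gaussIso (a + (b - a) * g x) ^ 2 + ‖(b - a) • g' x‖ ^ 2) ≤
        normalPDF M + S.indicator (fun _ => 1 + L) x := fun x => by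
      by_cases hx : x ∈ S
      · rw [indicator_of_mem hx, Real.sqrt_le_left (by have := normalPDF_pos M; positivity)]
        have h1 := pow_le_pow_left₀ (gaussIso_pos _).le (gaussIso_le_one (a + (b - a) * g x)) 2
        have h2 := pow_le_pow_left₀ (norm_nonneg _) ((hnorm _).trans (hL x)) 2
        nlinarith [normalPDF_pos M]
      · rw [indicator_of_notMem hx, hg0 x hx, smul_zero, norm_zero, add_zero,
          zero_pow two_ne_zero, add_zero, Real.sqrt_sq (gaussIso_pos _).le]
        rcases hgS x hx with h0 | h1
        · rw [h0, mul_zero, add_zero, gaussIso, ha, normalCDFInv_normalCDF, normalPDF_neg]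
        · rw [h1, mul_one, add_sub_cancel, gaussIso, hb, normalCDFInv_normalCDF]
    calc _ ≤ ∫ x, normalPDF M + S.indicator (fun _ => 1 + L) x ∂stdGaussian V :=
          integral_mono_of_nonneg (ae_of_all _ fun x => Real.sqrt_nonneg _) hi (ae_of_all _ hpt)
      _ = _ := by
          rw [integral_add (integrable_const _) ((integrable_const _).indicator hS),
            integral_indicator_const _ hS]
          simp [mul_comm]
  have hlow : Tendsto (fun M => normalCDF (-M)) atTop (𝓝 0) :=
    (tendsto_cdf_atBot (gaussianReal 0 1)).comp tendsto_neg_atTop_atBot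
  have hhigh : Tendsto normalCDF atTop (𝓝 1) := tendsto_cdf_atTop (gaussianReal 0 1)
  have harg := hlow.add ((hhigh.sub hlow).mul_const (∫ x, g x ∂stdGaussian V))
  simp only [sub_zero, one_mul, zero_add] at harg
  have hlim1 := (continuousOn_gaussIso.continuousAt (isOpen_Ioo.mem_nhds hm)).tendsto.comp harg
  have hlim2 := tendsto_normalPDF_atTop.add_const ((1 + L) * (stdGaussian V).real S)
  rw [zero_add] at hlim2
  refine le_of_tendsto_of_tendsto hlim1 hlim2 ?_
  filter_upwards [eventually_gt_atTop 0] with M hM0 using hM M hM0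

/-! ### Smooth cutoffs of thin neighbourhoods -/

section Mollify

variable {V : Type*} [NormedAddCommGroup V] [NormedSpace ℝ V] [FiniteDimensional ℝ V]

/-- A Lipschitz function with values in `[0, 1]` can be smoothed at scale `δ`, to a function with
Lipschitz derivative, without increasing its Lipschitz constant. -/
theorem exists_smooth_of_lipschitz {u : V → ℝ} {L : ℝ≥0} (hu : LipschitzWith L u)
    (h01 : ∀ x, u x ∈ Icc (0 : ℝ) 1) {δ : ℝ} (hδ : 0 < δ) :
    ∃ (g : V → ℝ) (g' : V → V →L[ℝ] ℝ) (K : ℝ), 0 ≤ K ∧ (∀ x, HasFDerivAt g (g' x) x) ∧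
      (∀ x y, ‖g' x - g' y‖ ≤ K * ‖x - y‖) ∧ (∀ x, ‖g' x‖ ≤ L) ∧ (∀ x, g x ∈ Icc (0 : ℝ) 1) ∧
      ∀ x, (∀ y ∈ Metric.ball x δ, u y = u x) → g x = u x := by
  classical
  let _ : MeasurableSpace V := borel V
  have : BorelSpace V := ⟨rfl⟩
  let μ : Measure V := Measure.addHaar
  let φ : ContDiffBump (0 : V) := ⟨δ / 2, δ, by positivity, by linarith⟩
  let ρ : V → ℝ := φ.normed μ
  let M := ContinuousLinearMap.lsmul ℝ ℝ (E := ℝ)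
  have hρ1 : ContDiff ℝ 1 ρ := φ.contDiff_normed (n := 1)
  have hρs : HasCompactSupport ρ := φ.hasCompactSupport_normed
  have hρi : Integrable ρ μ := φ.integrable_normed
  have hρ0 : ∀ x, 0 ≤ ρ x := φ.nonneg_normed
  have hρint : ∫ x, ρ x ∂μ = 1 := φ.integral_normed
  have hul : LocallyIntegrable u μ := hu.continuous.locallyIntegrable
  have hgi : ∀ x, Integrable (fun t => ρ t * u (x - t)) μ := fun x =>
    (hρs.convolutionExists_left M hρ1.continuous hul x).integrable
  have hgx : ∀ x, (ρ ⋆[M, μ] u) x = ∫ t, ρ t * u (x - t) ∂μ := fun x => rfl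
  have hudiff : ∀ x y t, |u (x - t) - u (y - t)| ≤ L * ‖x - y‖ := fun x y t => by
    simpa [dist_eq_norm] using hu.dist_le_mul (x - t) (y - t)
  have hglip : LipschitzWith L (ρ ⋆[M, μ] u) := by
    refine LipschitzWith.of_dist_le_mul fun x y => ?_
    rw [dist_eq_norm, dist_eq_norm, hgx, hgx, ← integral_sub (hgi x) (hgi y)]
    have hb : ∀ t, ‖ρ t * u (x - t) - ρ t * u (y - t)‖ ≤ ρ t * (L * ‖x - y‖) := fun t => by
      rw [← mul_sub, norm_mul, Real.norm_of_nonneg (hρ0 t)]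
      exact mul_le_mul_of_nonneg_left (hudiff x y t) (hρ0 t)
    refine (norm_integral_le_of_norm_le (hρi.mul_const _) (ae_of_all _ hb)).trans ?_
    rw [integral_mul_const, hρint, one_mul]
  let M' := M.precompL V
  have hd : ∀ x, HasFDerivAt (ρ ⋆[M, μ] u) ((fderiv ℝ ρ ⋆[M', μ] u) x) x := fun x =>
    hρs.hasFDerivAt_convolution_left M hρ1 hul x
  have hdc : Continuous (fderiv ℝ ρ) := hρ1.continuous_fderiv one_ne_zero
  have hds : HasCompactSupport (fderiv ℝ ρ) := hρs.fderiv ℝ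
  have hdi : ∀ x, Integrable (fun t => M' (fderiv ℝ ρ t) (u (x - t))) μ := fun x =>
    (hds.convolutionExists_left M' hdc hul x).integrable
  have hdn : Integrable (fun t => ‖fderiv ℝ ρ t‖) μ :=
    (hdc.integrable_of_hasCompactSupport hds).norm
  have hM' : ∀ (ℓ : V →L[ℝ] ℝ) (s : ℝ), M' ℓ s = s • ℓ := fun ℓ s => by
    ext v
    simp [M', M, ContinuousLinearMap.precompL_apply, mul_comm]
  -- The derivative is placed on the bump ρ; as u is L-Lipschitz, the derivative of the convolution
  -- is Lipschitz with constant L ∫ ‖∇ρ‖.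
  refine ⟨ρ ⋆[M, μ] u, fderiv ℝ ρ ⋆[M', μ] u, (∫ t, ‖fderiv ℝ ρ t‖ ∂μ) * L, by positivity,
    hd, fun x y => ?_, fun x => (hd x).le_of_lipschitz hglip, fun x => ⟨?_, ?_⟩, fun x hx => ?_⟩
  · have hb : ∀ t, ‖M' (fderiv ℝ ρ t) (u (x - t)) - M' (fderiv ℝ ρ t) (u (y - t))‖ ≤
        ‖fderiv ℝ ρ t‖ * (L * ‖x - y‖) := fun t => by
      rw [hM', hM', ← sub_smul, norm_smul, mul_comm]
      exact mul_le_mul_of_nonneg_left (hudiff x y t) (norm_nonneg _)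
    rw [convolution_def, convolution_def, ← integral_sub (hdi x) (hdi y)]
    refine (norm_integral_le_of_norm_le (hdn.mul_const _) (ae_of_all _ hb)).trans ?_
    rw [integral_mul_const]
    apply le_of_eq
    ring
  · exact integral_nonneg fun t => mul_nonneg (hρ0 t) (h01 _).1
  · rw [hgx, ← hρint]
    exact integral_mono (hgi x) hρi fun t => mul_le_of_le_one_right (hρ0 t) (h01 _).2
  · exact φ.normed_convolution_eq_right hx

end Mollify

/-- A Lipschitz function that is `1` on the `δ`-neighbourhood of `A` and `0` at distance at least
`r - δ` from `A`. -/
theorem exists_lipschitz_cutoff {X : Type*} [PseudoMetricSpace X] (A : Set X) {r δ : ℝ}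
    (hr : 2 * δ < r) :
    ∃ u : X → ℝ, LipschitzWith (Real.toNNReal (1 / (r - 2 * δ))) u ∧
      (∀ x, u x ∈ Icc (0 : ℝ) 1) ∧ (∀ x, Metric.infDist x A ≤ δ → u x = 1) ∧
      ∀ x, r - δ ≤ Metric.infDist x A → u x = 0 := by
  have hpos : 0 < r - 2 * δ := by linarith
  refine ⟨fun x => max 0 (min 1 ((r - δ - Metric.infDist x A) / (r - 2 * δ))), ?_, ?_, ?_, ?_⟩
  · have h1 : LipschitzWith (Real.toNNReal (1 / (r - 2 * δ)))
        fun x => (r - δ - Metric.infDist x A) / (r - 2 * δ) := by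
      refine LipschitzWith.of_dist_le_mul fun x y => ?_
      rw [Real.coe_toNNReal _ (by positivity), Real.dist_eq, ← sub_div, abs_div,
        abs_of_pos hpos, div_mul_eq_mul_div, one_mul]
      gcongr
      have := (Metric.lipschitz_infDist_pt A).dist_le_mul y x
      rw [Real.dist_eq, NNReal.coe_one, one_mul, dist_comm] at this
      rwa [sub_sub_sub_cancel_left]
    exact (h1.const_min 1).const_max 0
  · exact fun x => ⟨le_max_left _ _, max_le zero_le_one (min_le_left _ _)⟩
  · intro x hx
    simp only
    rw [min_eq_left, max_eq_right zero_le_one]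
    rw [one_le_div hpos]
    linarith
  · intro x hx
    simp only
    rw [max_eq_left]
    exact (min_le_right _ _).trans (div_nonpos_of_nonpos_of_nonneg (by linarith) hpos.le)

/-- Functional form of the Gaussian isoperimetric inequality for a thin neighbourhood. -/
theorem exists_gaussIso_le_thickening {V : Type*} [NormedAddCommGroup V]
    [InnerProductSpace ℝ V] [FiniteDimensional ℝ V] [MeasurableSpace V] [BorelSpace V]
    {A : Set V} (hA : MeasurableSet A) (h0 : 0 < (stdGaussian V).real A) {r δ : ℝ} (hδ : 0 < δ)
    (hr : 2 * δ < r) (h1 : (stdGaussian V).real (Metric.thickening r A) < 1) :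
    ∃ m ∈ Icc ((stdGaussian V).real A) ((stdGaussian V).real (Metric.thickening r A)),
      gaussIso m ≤ (1 + 1 / (r - 2 * δ)) * (stdGaussian V).real (Metric.thickening r A \ A) := by
  have hne : A.Nonempty := by
    by_contra h
    rw [not_nonempty_iff_eq_empty.1 h] at h0
    simp at h0
  -- The margins of width δ at both ends of the cutoff keep u constant on the δ-balls used for
  -- smoothing, so g is still 1 on A and 0 off the thickening.
  obtain ⟨u, hul, hu01, hu1, hu0⟩ := exists_lipschitz_cutoff A hr
  obtain ⟨g, g', K, hK0, hg, hK, hL, h01, hgu⟩ := exists_smooth_of_lipschitz hul hu01 hδ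
  rw [Real.coe_toNNReal _ (by have : 0 < r - 2 * δ := by linarith
                              positivity)] at hL
  have hgA : ∀ x ∈ A, g x = 1 := fun x hx => by
    have hz : Metric.infDist x A = 0 := Metric.infDist_zero_of_mem hx
    have hux := hu1 x (by rw [hz]; exact hδ.le)
    rw [hgu x fun y hy => ?_, hux]
    rw [hux]
    exact hu1 y ((Metric.infDist_le_dist_of_mem hx).trans hy.le)
  have hgT : ∀ x ∉ Metric.thickening r A, g x = 0 := fun x hx => by
    have hxr : r ≤ Metric.infDist x A := by
      by_contra! h
      obtain ⟨y, hy, hxy⟩ := (Metric.infDist_lt_iff hne).1 h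
      exact hx (Metric.mem_thickening_iff.2 ⟨y, hy, hxy⟩)
    have hux := hu0 x (by linarith)
    rw [hgu x fun y hy => ?_, hux]
    rw [hux]
    have hyd : dist y x < δ := hy
    have := Metric.infDist_le_infDist_add_dist (s := A) (x := x) (y := y)
    rw [dist_comm] at this
    exact hu0 y (by linarith)
  have hT : MeasurableSet (Metric.thickening r A) := Metric.isOpen_thickening.measurableSet
  have hgc : Continuous g := continuous_iff_continuousAt.2 fun x => (hg x).continuousAt
  have hgi : Integrable g (stdGaussian V) := integrable_of_continuous_of_bound hgc (C := 1)
    fun x => abs_le.2 ⟨by linarith [(h01 x).1], (h01 x).2⟩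
  have hm : ∫ x, g x ∂stdGaussian V ∈
      Icc ((stdGaussian V).real A) ((stdGaussian V).real (Metric.thickening r A)) := by
    constructor
    · rw [← integral_indicator_one hA]
      refine integral_mono ((integrable_const _).indicator hA) hgi fun x => ?_
      by_cases hx : x ∈ A
      · simp [hx, hgA]
      · simpa [hx] using (h01 x).1
    · rw [← integral_indicator_one hT]
      refine integral_mono hgi ((integrable_const _).indicator hT) fun x => ?_
      by_cases hx : x ∈ Metric.thickening r A
      · simpa [hx] using (h01 x).2
      · simp [hx, hgT]
  refine ⟨_, hm, gaussIso_integral_le_measureReal hg hK hK0 hL h01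
    ⟨h0.trans_le hm.1, hm.2.trans_lt h1⟩ (hT.diff hA) fun x hx => ?_⟩
  by_cases hxA : x ∈ A
  · exact Or.inr (hgA x hxA)
  · exact Or.inl (hgT x fun hxT => hx ⟨hxT, hxA⟩)

/-! ### Transfer to the pushforward, and the end points 0 and 1 -/

theorem psiEnlargement_id {F : Type*} [MetricSpace F] (ε : ℝ) (A : Set F) :
    psiEnlargement (id : F → F) ε A = Metric.thickening ε A := by
  ext x
  simp [psiEnlargement, psiDistToSet, psiDist, Metric.thickening, Metric.infEDist, edist_dist]

section Pushforward

variable {E F : Type*} [MeasurableSpace E] [MetricSpace F] [MeasurableSpace F]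

theorem psiEnlargement_preimage (ψ : E ≃ᵐ F) (ε : ℝ) (B : Set F) :
    psiEnlargement ψ ε (ψ ⁻¹' B) = ψ ⁻¹' psiEnlargement (id : F → F) ε B := by
  ext x
  have : psiDistToSet ψ x (ψ ⁻¹' B) = psiDistToSet (id : F → F) (ψ x) B := by
    simp only [psiDistToSet, psiDist, mem_preimage, id]
    exact ψ.toEquiv.iInf_congr fun y => rfl
  simp only [psiEnlargement, mem_ofPred_eq, mem_preimage, this]

theorem psiPerimeter_preimage (μ : Measure E) (ψ : E ≃ᵐ F) (B : Set F) :
    psiPerimeter ψ μ (ψ ⁻¹' B) = psiPerimeter (id : F → F) (μ.map ψ) B := by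
  simp only [psiPerimeter, psiEnlargement_preimage, ψ.map_apply]

/-- The `ψ`-isoperimetric profile is the isoperimetric profile of the pushforward. -/
theorem psiProfile_eq_map (μ : Measure E) (ψ : E ≃ᵐ F) :
    psiProfile ψ μ = psiProfile (id : F → F) (μ.map ψ) := by
  ext v
  have hreal : ∀ B : Set F, (μ.map ψ).real B = μ.real (ψ ⁻¹' B) := fun B => by
    simp only [measureReal_def, ψ.map_apply]
  apply le_antisymm
  · refine le_iInf fun B => le_iInf fun hB => le_iInf fun hv => ?_
    rw [← psiPerimeter_preimage]
    exact iInf_le_of_le (ψ ⁻¹' B) (iInf₂_le (ψ.measurable hB) ((hreal B).symm.trans hv))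
  · refine le_iInf fun A => le_iInf fun hA => le_iInf fun hv => ?_
    have hpre : ψ ⁻¹' (ψ.symm ⁻¹' A) = A := by
      ext x
      simp
    rw [← hpre, psiPerimeter_preimage]
    exact iInf_le_of_le (ψ.symm ⁻¹' A) (iInf₂_le (ψ.symm.measurable hA)
      (by rw [hreal, hpre, hv]))

end Pushforward

theorem psiProfile_eq_zero {E F : Type*} [MeasurableSpace E] [MetricSpace F] (ψ : E → F)
    (μ : Measure E) {A : Set E} (hA : MeasurableSet A) (h : ∀ ε, psiEnlargement ψ ε A ⊆ A) {v : ℝ}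
    (hv : μ.real A = v) : psiProfile ψ μ v = 0 := by
  have hzero : psiPerimeter ψ μ A = 0 := by
    have : ∀ ε, (μ (psiEnlargement ψ ε A) - μ A) / ENNReal.ofReal ε = 0 := fun ε => by
      rw [tsub_eq_zero_of_le (measure_mono (h ε)), ENNReal.zero_div]
    simp [psiPerimeter, this]
  exact le_antisymm ((iInf_le_of_le A (iInf₂_le hA hv)).trans hzero.le) bot_le

/-- The empty set is at distance ∞ from every point, so its enlargements are empty. -/
theorem psiProfile_zero {E F : Type*} [MeasurableSpace E] [MetricSpace F] (ψ : E → F)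
    (μ : Measure E) : psiProfile ψ μ 0 = 0 :=
  psiProfile_eq_zero ψ μ MeasurableSet.empty
    (fun ε x hx => by simp [psiEnlargement, psiDistToSet] at hx) (by simp)

theorem psiProfile_one {E F : Type*} [MeasurableSpace E] [MetricSpace F] (ψ : E → F)
    (μ : Measure E) [IsProbabilityMeasure μ] : psiProfile ψ μ 1 = 0 :=
  psiProfile_eq_zero ψ μ MeasurableSet.univ (fun _ => subset_univ _) (by simp)

/-! ### The Gaussian isoperimetric inequality and half-spaces -/

section Gaussian

variable {V : Type*} [NormedAddCommGroup V] [InnerProductSpace ℝ V] [FiniteDimensional ℝ V]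
  [MeasurableSpace V] [BorelSpace V]

/-- The **Gaussian isoperimetric inequality**, for the perimeter. -/
theorem gaussIso_le_psiPerimeter {A : Set V} (hA : MeasurableSet A)
    (hv : (stdGaussian V).real A ∈ Ioo (0 : ℝ) 1) :
    ENNReal.ofReal (gaussIso ((stdGaussian V).real A)) ≤
      psiPerimeter (id : V → V) (stdGaussian V) A := by
  set γ := stdGaussian V
  set v := γ.real A with hvdef
  by_contra! hlt
  obtain ⟨c, hc1, hc2⟩ := ENNReal.lt_iff_exists_nnreal_btwn.1 hlt
  have hc2' : (c : ℝ) < gaussIso v := by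
    rw [← ENNReal.ofReal_coe_nnreal, ENNReal.ofReal_lt_ofReal_iff (gaussIso_pos _)] at hc2
    exact hc2
  obtain ⟨d, hcd, hdI⟩ := exists_between hc2'
  have hfreq := frequently_lt_of_liminf_lt (by isBoundedDefault) hc1
  have hcont : ∀ᶠ m in 𝓝 v, m < 1 ∧ d < gaussIso m :=
    (eventually_lt_nhds hv.2).and
      ((hasDerivAt_gaussIso hv).continuousAt.eventually_const_lt hdI)
  obtain ⟨η, hη, hball⟩ := Metric.eventually_nhds_iff.1 hcont
  -- The expression c(ε + 1/(1 - 2ε)) is the bound obtained below when the cutoff has margin δ = ε².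
  -- It tends to c < d, while d < I(m) for m within η of v.
  have hsmall : ∀ᶠ ε : ℝ in 𝓝 0, c * (ε + 1 / (1 - 2 * ε)) < d ∧ c * ε < η ∧ ε < 1 / 2 := by
    refine Eventually.and ?_ (Eventually.and ?_ (eventually_lt_nhds (by norm_num)))
    · have : ContinuousAt (fun ε : ℝ => c * (ε + 1 / (1 - 2 * ε))) 0 := by
        refine continuousAt_const.mul (continuousAt_id.add (continuousAt_const.div ?_ (by simp)))
        fun_prop
      refine this.eventually_lt_const ?_
      simpa using hcd
    · have : ContinuousAt (fun ε : ℝ => c * ε) 0 := by fun_prop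
      exact this.eventually_lt_const (by simpa using hη)
  obtain ⟨ε, hq, hε0, hε1, hε2, hε3⟩ := (hfreq.and_eventually
    (eventually_mem_nhdsWithin.and (hsmall.filter_mono nhdsWithin_le_nhds))).exists
  have hε0 : 0 < ε := hε0
  rw [psiEnlargement_id] at hq
  set T := Metric.thickening ε A with hT
  have hAT : A ⊆ T := Metric.self_subset_thickening hε0 A
  have hTm : MeasurableSet T := Metric.isOpen_thickening.measurableSet
  have hS : γ.real (T \ A) ≤ c * ε := by
    rw [← measure_sdiff hAT hA.nullMeasurableSet (measure_ne_top _ _)] at hq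
    have h := (ENNReal.div_le_iff (by simpa using hε0) ENNReal.ofReal_ne_top).1 hq.le
    rw [measureReal_def]
    refine ENNReal.toReal_le_of_le_ofReal (by positivity) (h.trans_eq ?_)
    rw [ENNReal.ofReal_mul c.coe_nonneg, ENNReal.ofReal_coe_nnreal]
  have hTA : γ.real T = v + γ.real (T \ A) := by
    rw [measureReal_sdiff hAT hA, hvdef]
    ring
  have hclose : ∀ m ∈ Icc v (γ.real T), dist m v < η := fun m hm => by
    rw [Real.dist_eq, abs_of_nonneg (by linarith [hm.1])]
    linarith [hm.2]
  have hvT : v ≤ γ.real T := measureReal_mono hAT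
  -- A margin δ = ε² is negligible against ε, so the cutoff slope 1/(ε - 2ε²) is asymptotic to 1/ε
  -- and no constant is lost.
  obtain ⟨m, hm, hle⟩ := exists_gaussIso_le_thickening hA hv.1 (r := ε) (δ := ε ^ 2)
    (by positivity) (by nlinarith) (hball (hclose _ ⟨hvT, le_rfl⟩)).1
  have h1 := (hball (hclose m hm)).2
  have hpos : 0 < 1 - 2 * ε := by linarith
  have h2 : (1 + 1 / (ε - 2 * ε ^ 2)) * (c * ε) = c * (ε + 1 / (1 - 2 * ε)) := by
    rw [show ε - 2 * ε ^ 2 = ε * (1 - 2 * ε) by ring]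
    field_simp
  have h3 : 0 ≤ 1 + 1 / (ε - 2 * ε ^ 2) := by
    rw [show ε - 2 * ε ^ 2 = ε * (1 - 2 * ε) by ring]
    positivity
  have h4 := hle.trans (mul_le_mul_of_nonneg_left hS h3)
  linarith

/-- Both laws have characteristic function exp(-t²/2), as seen by evaluating that of the standard
Gaussian at t • e. -/
theorem stdGaussian_map_inner {e : V} (he : ‖e‖ = 1) :
    (stdGaussian V).map (fun x => inner ℝ e x) = gaussianReal 0 1 := by
  apply Measure.ext_of_charFun
  ext t
  have hm : Measurable fun x : V => inner ℝ e x := by fun_prop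
  rw [charFun_gaussianReal, charFun_apply_real, integral_map hm.aemeasurable
    (Continuous.aestronglyMeasurable (by fun_prop))]
  have h := charFun_stdGaussian (t • e)
  rw [charFun_apply] at h
  simp only [inner_smul_right, real_inner_comm, norm_smul, he, mul_one, Real.norm_eq_abs,
    ← Complex.ofReal_pow, sq_abs] at h
  simpa [real_inner_comm, neg_div] using h

theorem stdGaussian_real_inner_le {e : V} (he : ‖e‖ = 1) (t : ℝ) :
    (stdGaussian V).real {x | inner ℝ e x ≤ t} = normalCDF t := by
  rw [normalCDF, cdf_eq_real, ← stdGaussian_map_inner he, measureReal_def, measureReal_def,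
    Measure.map_apply (by fun_prop) measurableSet_Iic]
  rfl

theorem psiPerimeter_halfSpace_le {e : V} (he : ‖e‖ = 1) (t : ℝ) :
    psiPerimeter (id : V → V) (stdGaussian V) {x | inner ℝ e x ≤ t} ≤
      ENNReal.ofReal (normalPDF t) := by
  set γ := stdGaussian V
  set A : ℝ → Set V := fun s => {x | inner ℝ e x ≤ s} with hA
  have hsub : ∀ ε, Metric.thickening ε (A t) ⊆ A (t + ε) := fun ε x hx => by
    obtain ⟨y, hy, hxy⟩ := Metric.mem_thickening_iff.1 hx
    have h1 : inner ℝ e (x - y) ≤ ‖x - y‖ := by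
      simpa [he] using real_inner_le_norm e (x - y)
    rw [inner_sub_right] at h1
    rw [dist_eq_norm] at hxy
    have hy : inner ℝ e y ≤ t := hy
    change inner ℝ e x ≤ t + ε
    linarith
  have hmeas : ∀ s, γ (A s) = ENNReal.ofReal (normalCDF s) := fun s => by
    rw [← stdGaussian_real_inner_le he s, ofReal_measureReal]
  have hslope : Tendsto (fun ε : ℝ => (normalCDF (t + ε) - normalCDF t) / ε) (𝓝[>] 0)
      (𝓝 (normalPDF t)) := by
    have h := (hasDerivAt_normalCDF t).tendsto_slope_zero_right
    refine h.congr fun ε => ?_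
    rw [smul_eq_mul, div_eq_inv_mul]
  have hlim := ENNReal.tendsto_ofReal hslope
  -- Only the inclusion of the enlargement in a shifted half-space is needed, since an upper bound
  -- on the difference quotient suffices.
  rw [← hlim.liminf_eq]
  refine liminf_le_liminf ?_
  filter_upwards [self_mem_nhdsWithin] with ε hε
  have hε : 0 < ε := hε
  rw [psiEnlargement_id, ENNReal.ofReal_div_of_pos hε,
    ENNReal.ofReal_sub _ (normalCDF_mem_Ioo t).1.le, ← hmeas, ← hmeas]
  gcongr
  exact hsub ε

theorem psiProfile_stdGaussian [Nontrivial V] {v : ℝ} (hv : v ∈ Ioo (0 : ℝ) 1) :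
    psiProfile (id : V → V) (stdGaussian V) v =
      ENNReal.ofReal (normalPDF (normalCDFInv v)) := by
  apply le_antisymm
  · obtain ⟨e, he⟩ := exists_norm_eq V zero_le_one
    exact iInf_le_of_le {x | inner ℝ e x ≤ normalCDFInv v} (iInf_le_of_le
      (measurableSet_le (by fun_prop) (by fun_prop)) (iInf_le_of_le
        ((stdGaussian_real_inner_le he _).trans (normalCDF_normalCDFInv hv))
        (psiPerimeter_halfSpace_le he _)))
  · refine le_iInf fun A => le_iInf fun hA => le_iInf fun hAv => ?_
    subst hAv
    exact gaussIso_le_psiPerimeter hA hv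

end Gaussian

end PsiIso

theorem theorem7p1 {E : Type*} [MeasurableSpace E] (μ : Measure E) [IsProbabilityMeasure μ] :
    (∀ {F : Type*} [MetricSpace F] [MeasurableSpace F] [OpensMeasurableSpace F] (ψ : E ≃ᵐ F),
      PsiIso.psiProfile ψ μ = PsiIso.psiProfile (id : F → F) (μ.map ψ)) ∧
    (∀ (n : ℕ), 1 ≤ n → ∀ (ψ : E ≃ᵐ EuclideanSpace ℝ (Fin n)),
      μ.map ψ = stdGaussian (EuclideanSpace ℝ (Fin n)) →
        (∀ v ∈ Ioo (0 : ℝ) 1, PsiIso.psiProfile ψ μ v =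
          ENNReal.ofReal (PsiIso.normalPDF (PsiIso.normalCDFInv v))) ∧
        PsiIso.psiProfile ψ μ 0 = 0 ∧ PsiIso.psiProfile ψ μ 1 = 0) := by
  refine ⟨fun ψ => PsiIso.psiProfile_eq_map μ ψ, fun n hn ψ hψ =>
    ⟨fun v hv => ?_, PsiIso.psiProfile_zero ψ μ, PsiIso.psiProfile_one ψ μ⟩⟩
  have : Nonempty (Fin n) := ⟨⟨0, hn⟩⟩
  rw [PsiIso.psiProfile_eq_map, hψ, PsiIso.psiProfile_stdGaussian hv]
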